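/- Let $n\ge 0$. For a bounded Lebesgue measurable set $\Omega\subseteq\mathbb{R}^d$, a set $\Lambda\subseteq\mathbb{R}^d$ is called a spectrum of $\Omega$ if the exponentials $e_\lambda(x)=e^{2\pi i\lambda\cdot x}$, $\lambda\in\Lambda$, form a complete orthogonal set in $L^2(\Omega)$ with the inner product $\langle f,g\rangle=\int_\Omega f\overline{g}$; that is, $\langle e_\lambda,e_\mu\rangle=0$ for all distinct $\lambda,\mu\in\Lambda$, and the only $f\in L^2(\Omega)$ with $\langle f,e_\lambda\rangle=0$ for all $\lambda\in\Lambda$ is $f=0$. The set $\Omega$ is called spectral if it has a spectrum. Let $I,J\subseteq\mathbb{R}$ be two disjoint bounded closed intervals, at least one of which has positive length, and let $B\subseteq\mathbb{R}^n$ be a bounded Lebesgue measurable set of positive measure. If $(I\cup J)\times B\subseteq\mathbb{R}^{1+n}$ is spectral, then both $I\cup J\subseteq\mathbb{R}$ and $B\subseteq\mathbb{R}^n$ are spectral. -/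

import Mathlib

open MeasureTheory

noncomputable section

/-- The exponential `x ↦ e^{2πi ξ·x}` with frequency `ξ`. -/
def expFun {V : Type*} [NormedAddCommGroup V] [InnerProductSpace ℝ V] (ξ x : V) : ℂ :=
  Complex.exp (2 * (Real.pi : ℂ) * Complex.I * ((inner ℝ ξ x : ℝ) : ℂ))

/-- `Λ` is a spectrum of `Ω`: the exponentials with frequencies in `Λ` form a complete orthogonal
set in `L²(Ω)`, with the inner product `⟨f, g⟩ = ∫_Ω f \bar g`. Complete means that only the zero
element of `L²(Ω)` is orthogonal to all of them. The first field is automatic when `Ω` is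
bounded. -/
structure IsSpectrum {V : Type*} [NormedAddCommGroup V] [InnerProductSpace ℝ V] [MeasureSpace V]
    (Ω Λ : Set V) : Prop where
  memLp : ∀ ξ ∈ Λ, MemLp (expFun ξ) 2 (volume.restrict Ω)
  orthogonal : ∀ ξ ∈ Λ, ∀ η ∈ Λ, ξ ≠ η →
    ∫ x in Ω, expFun ξ x * (starRingEnd ℂ) (expFun η x) = 0
  complete : ∀ f : V → ℂ, MemLp f 2 (volume.restrict Ω) →
    (∀ ξ ∈ Λ, ∫ x in Ω, f x * (starRingEnd ℂ) (expFun ξ x) = 0) →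
    f =ᵐ[volume.restrict Ω] 0

/-- `Ω` is a spectral set: it has a spectrum. -/
def IsSpectral {V : Type*} [NormedAddCommGroup V] [InnerProductSpace ℝ V] [MeasureSpace V]
    (Ω : Set V) : Prop :=
  ∃ Λ : Set V, IsSpectrum Ω Λ

/-- The product set `A × B` in `ℝ^{1+n}`, for `A ⊆ ℝ` and `B ⊆ ℝⁿ`: the first coordinate is in `A`
and the vector of the remaining `n` coordinates is in `B`. -/
def cylinderSet {n : ℕ} (A : Set ℝ) (B : Set (EuclideanSpace ℝ (Fin n))) :
    Set (EuclideanSpace ℝ (Fin (n + 1))) :=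
  {x | x 0 ∈ A ∧ WithLp.toLp 2 (fun i : Fin n => x i.succ) ∈ B}

end

/-!
Let `A = I ∪ J`, of total length `l`, and let `Λ` be a spectrum of `A × B`. Write `φ_S` for the
Fourier transform `indFT S` of the indicator function of `S`; exponentials with frequencies `ξ`, `η`
are orthogonal in `L²(S)` exactly when `φ_S (ξ - η) = 0`, and `φ_{A × B}` is the product of `φ_A`
and `φ_B`.

The proof compares a tiling with a packing by the same translates. By Parseval, the translates along
`Λ` of `F = |φ_A|² ⊗ |φ_B|²` add up to the constant `(|A| |B|)²`. Let `T ⊆ ℝ` be a set no nonzero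
difference of which is a zero of `φ_A`. The elements of `Λ` whose first coordinate lies in a fixed
translate of `-T` then have second coordinates that are orthogonal for `B`, so by Bessel the
translates along `Λ` of `g = 1_T ⊗ |φ_B|²` add up to at most `|B|²`. Convolving one sum with the
other function (`lintegral_mul_tsum_translate`) and computing the integrals with Plancherel's
theorem (`lintegral_enorm_indFT_sq`) gives `|A| |T| ≤ 1`. If `|A| |T| = 1`, then the packing is a
tiling (`ae_tsum_packing_eq`), so that Bessel's inequality is an equality at almost every frequency,
and `B` is spectral (`volume_mul_le_one_and_isSpectral`).

It remains to choose `T`. The zeros of `φ_A` are found from the fact that two pairs of unit complex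
numbers with equal sums agree or have sum zero (`exists_int_of_indFT_eq_zero`).

* If the lengths differ (`isSpectral_of_length_ne`), then `φ_A` has no zero in `(0, l⁻¹)`, and
  `T = [0, l⁻¹)` shows that `B` is spectral. If both lengths are positive and `l⁻¹` is not a zero
  either, then a longer interval is admissible, contrary to `|A| |T| ≤ 1`. So `l⁻¹` is a zero, which
  says that the gap between the intervals is a multiple of `l`; then `l⁻¹ℤ` is a spectrum of `A`.
* If both intervals have length `r`, one being the translate of the other by `s`
  (`isSpectral_of_length_eq`), then `T = {t ∈ [0, r⁻¹) | ⌊2st⌋ is even}` is admissible. It has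
  measure at least `(2r)⁻¹ = l⁻¹`, and more than that unless `s` is a multiple of `r`. So `s` is a
  multiple of `r`, which makes `A` spectral, and `B` is spectral by the case of equality.
-/

noncomputable section
open scoped FourierTransform ENNReal ComplexConjugate

/-! ### Exponentials and Plancherel's theorem -/


section Exponentials

variable {V : Type*} [NormedAddCommGroup V] [InnerProductSpace ℝ V]

lemma expFun_eq_fourierChar (ξ x : V) : expFun ξ x = Real.fourierChar (inner ℝ ξ x) := by
  rw [expFun, Real.fourierChar_apply]
  congr 1
  push_cast
  ring

@[simp]
lemma norm_expFun (ξ x : V) : ‖expFun ξ x‖ = 1 := by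
  rw [expFun_eq_fourierChar]
  exact Circle.norm_coe _

@[simp]
lemma expFun_zero_left (x : V) : expFun 0 x = 1 := by simp [expFun]

lemma expFun_add_left (ξ η x : V) : expFun (ξ + η) x = expFun ξ x * expFun η x := by
  simp only [expFun, ← Complex.exp_add, inner_add_left]
  congr 1
  push_cast
  ring

lemma expFun_add_right (ξ x y : V) : expFun ξ (x + y) = expFun ξ x * expFun ξ y := by
  simp only [expFun, ← Complex.exp_add, inner_add_right]
  congr 1
  push_cast
  ring

lemma conj_expFun (ξ x : V) : conj (expFun ξ x) = expFun (-ξ) x := by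
  simp only [expFun, ← Complex.exp_conj]
  congr 1
  simp [Complex.conj_ofNat]

lemma expFun_mul_conj (ξ η x : V) : expFun ξ x * conj (expFun η x) = expFun (ξ - η) x := by
  rw [conj_expFun, ← expFun_add_left, sub_eq_add_neg]

lemma continuous_expFun (ξ : V) : Continuous (expFun ξ) := by
  unfold expFun
  fun_prop

lemma continuous_expFun_left (x : V) : Continuous fun ξ : V => expFun ξ x := by
  unfold expFun
  fun_prop

variable [MeasureSpace V] [BorelSpace V]

lemma aestronglyMeasurable_expFun [FiniteDimensional ℝ V] (ξ : V) (μ : Measure V) :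
    AEStronglyMeasurable (expFun ξ) μ :=
  (continuous_expFun ξ).aestronglyMeasurable

lemma memLp_expFun [FiniteDimensional ℝ V] (ξ : V) (p : ℝ≥0∞) {μ : Measure V}
    [IsFiniteMeasure μ] : MemLp (expFun ξ) p μ :=
  MemLp.of_bound (aestronglyMeasurable_expFun ξ μ) 1 (by simp)

end Exponentials

section Plancherel

variable {V : Type*} [NormedAddCommGroup V] [InnerProductSpace ℝ V] [FiniteDimensional ℝ V]
  [MeasurableSpace V] [BorelSpace V]

/-- On `L¹ ∩ L²` the Fourier transform of `L²` is given by the Fourier integral: both represent the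
same tempered distribution. -/
lemma fourier_toLp_ae_eq {f : V → ℂ} (h1 : Integrable f) (h2 : MemLp f 2) :
    (𝓕 h2.toLp : Lp ℂ 2 (volume : Measure V)) =ᵐ[volume] 𝓕 f := by
  have hcont : Continuous (𝓕 f) :=
    VectorFourier.fourierIntegral_continuous Real.continuous_fourierChar
      (by exact continuous_inner) h1
  have hl2 : LocallyIntegrable (𝓕 h2.toLp : Lp ℂ 2 (volume : Measure V)) volume :=
    (Lp.memLp _).locallyIntegrable (by norm_num)
  refine ae_eq_of_integral_contDiff_smul_eq hl2 hcont.locallyIntegrable fun g hg hgc => ?_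
  have hg1 : HasCompactSupport (Complex.ofRealCLM ∘ g) := hgc.comp_left (by simp)
  have hg2 : ContDiff ℝ (⊤ : ℕ∞) (Complex.ofRealCLM ∘ g) := by fun_prop
  set G := hg1.toSchwartzMap hg2 with hG
  have e1 := DFunLike.congr_fun (Lp.fourier_toTemperedDistribution_eq (h2.toLp (μ := volume))) G
  rw [TemperedDistribution.fourier_apply, Lp.toTemperedDistribution_apply,
    Lp.toTemperedDistribution_apply] at e1
  have e2 : ∫ ξ, (𝓕 f ξ) • (G ξ) = ∫ x, f x • (𝓕 (G : V → ℂ) x) := by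
    have := VectorFourier.integral_fourierIntegral_smul_eq_flip (μ := (volume : Measure V))
      (ν := (volume : Measure V)) (L := innerₗ V) (f := f) (g := G) Real.continuous_fourierChar
      (by exact continuous_inner) h1 G.integrable
    simpa [Real.fourier_eq, VectorFourier.fourierIntegral, real_inner_comm] using this
  have e3 : ∫ x, (𝓕 G : SchwartzMap V ℂ) x • (h2.toLp f x : ℂ) = ∫ x, f x • (𝓕 (G : V → ℂ) x) := by
    refine integral_congr_ae ?_
    filter_upwards [h2.coeFn_toLp] with x hx
    rw [hx, SchwartzMap.fourier_coe, smul_eq_mul, smul_eq_mul, mul_comm]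
  have hGg : ∀ x, G x = (g x : ℂ) := fun x => rfl
  rw [e3, ← e2] at e1
  simp only [hGg, smul_eq_mul] at e1
  simp only [Complex.real_smul]
  rw [← e1]
  exact integral_congr_ae (.of_forall fun x => mul_comm _ _)

/-- **Plancherel's theorem** on `L¹ ∩ L²`. -/
lemma lintegral_enorm_fourier_sq {f : V → ℂ} (h1 : Integrable f) (h2 : MemLp f 2) :
    ∫⁻ ξ, ‖𝓕 f ξ‖ₑ ^ 2 = ∫⁻ x, ‖f x‖ₑ ^ 2 := by
  have key : eLpNorm (𝓕 f) 2 volume = eLpNorm f 2 volume := by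
    rw [← eLpNorm_congr_ae (fourier_toLp_ae_eq h1 h2), ← eLpNorm_congr_ae h2.coeFn_toLp,
      ← Lp.enorm_def, ← Lp.enorm_def, ← ofReal_norm, ← ofReal_norm, Lp.norm_fourier_eq]
  have hsq : ∀ u : V → ℂ, ∫⁻ x, ‖u x‖ₑ ^ 2 = eLpNorm u 2 volume ^ 2 := by
    intro u
    have := eLpNorm_nnreal_pow_eq_lintegral (f := u) (μ := (volume : Measure V)) (p := 2)
      (by norm_num)
    simpa using this.symm
  rw [hsq, hsq, key]

end Plancherel

section IndicatorTransform

variable {V : Type*} [NormedAddCommGroup V] [InnerProductSpace ℝ V]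

/-- The Fourier transform of the indicator function of `S`, with the sign convention
`ξ ↦ ∫_S e^{2πi ξ·x} dx`, so that `⟨e_ξ, e_η⟩ = indFT S (ξ - η)` in `L²(S)`. -/
def indFT [MeasureSpace V] (S : Set V) (ξ : V) : ℂ := ∫ x in S, expFun ξ x

lemma indFT_zero [MeasureSpace V] (S : Set V) : indFT S 0 = volume.real S := by
  simp [indFT, Measure.real]

lemma indFT_neg [MeasureSpace V] (S : Set V) (ξ : V) : indFT S (-ξ) = conj (indFT S ξ) := by
  simp only [indFT, ← conj_expFun]
  exact integral_conj

variable [FiniteDimensional ℝ V] [MeasurableSpace V] [BorelSpace V]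

lemma continuous_indFT {S : Set V} (hS : volume S ≠ ∞) : Continuous (indFT S) := by
  have : IsFiniteMeasure (volume.restrict S) := ⟨by simpa using hS.lt_top⟩
  exact continuous_of_dominated (bound := fun _ => 1) (fun ξ => aestronglyMeasurable_expFun ξ _)
    (fun ξ => .of_forall fun x => by simp) (integrable_const _)
    (.of_forall fun x => continuous_expFun_left x)

/-- A Fourier integral over `S` is the Fourier transform of the function extended by zero. -/
lemma setIntegral_mul_conj_expFun {S : Set V} (hS : MeasurableSet S) (f : V → ℂ) (ξ : V) :
    ∫ x in S, f x * conj (expFun ξ x) = 𝓕 (S.indicator f) ξ := by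
  rw [Real.fourier_eq, ← integral_indicator hS]
  refine integral_congr_ae (.of_forall fun x => ?_)
  by_cases hx : x ∈ S
  · simp [hx, expFun_eq_fourierChar, Circle.smul_def, mul_comm,
      real_inner_comm]
  · simp [hx]

lemma lintegral_enorm_indFT_sq {S : Set V} (hS : MeasurableSet S) (hfin : volume S ≠ ∞) :
    ∫⁻ ξ, ‖indFT S ξ‖ₑ ^ 2 = volume S := by
  have h1 : ∀ ξ, ‖indFT S ξ‖ₑ = ‖𝓕 (S.indicator fun _ => (1 : ℂ)) ξ‖ₑ := by
    intro ξ
    rw [← setIntegral_mul_conj_expFun hS]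
    simp only [one_mul]
    rw [integral_conj, RCLike.enorm_conj]
    rfl
  simp only [h1]
  rw [lintegral_enorm_fourier_sq ((integrable_indicator_iff hS).2 (integrableOn_const hfin))
    (memLp_indicator_const 2 hS 1 (.inr hfin))]
  have : ∀ x, ‖S.indicator (fun _ => (1 : ℂ)) x‖ₑ ^ 2 = S.indicator 1 x := by
    intro x
    by_cases hx : x ∈ S <;> simp [hx]
  simp only [this]
  rw [lintegral_indicator_one hS]

/-- Injectivity of the Fourier transform on `L²(S)`, for `S` of finite measure. -/
lemma ae_eq_zero_of_setIntegral_conj_expFun {S : Set V} (hS : MeasurableSet S)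
    (hfin : volume S ≠ ∞) {f : V → ℂ} (hf : MemLp f 2 (volume.restrict S))
    (h : ∀ᵐ ξ, ∫ x in S, f x * conj (expFun ξ x) = 0) : f =ᵐ[volume.restrict S] 0 := by
  have : IsFiniteMeasure (volume.restrict S) := ⟨by simpa using hfin.lt_top⟩
  have h2 : MemLp (S.indicator f) 2 := (memLp_indicator_iff_restrict hS).2 hf
  have h1 : Integrable (S.indicator f) :=
    (integrable_indicator_iff hS).2 (hf.integrable one_le_two)
  have h0 : ∫⁻ x, ‖S.indicator f x‖ₑ ^ 2 = 0 := by
    rw [← lintegral_enorm_fourier_sq h1 h2, lintegral_eq_zero_iff' ?_]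
    · filter_upwards [h] with ξ hξ
      simp [← setIntegral_mul_conj_expFun hS, hξ]
    · have hcont : Continuous (𝓕 (S.indicator f)) :=
        VectorFourier.fourierIntegral_continuous Real.continuous_fourierChar
          (by exact continuous_inner) h1
      exact (hcont.measurable.enorm.pow_const 2).aemeasurable
  rw [lintegral_eq_zero_iff' (h1.aestronglyMeasurable.enorm.pow_const 2)] at h0
  rw [Filter.EventuallyEq, ae_restrict_iff' hS]
  filter_upwards [h0] with x hx hxS
  simpa [hxS] using hx

end IndicatorTransform

/-! ### Orthogonal exponentials in `L²(S)` -/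

section Hilbert

variable {E : Type*} [NormedAddCommGroup E] [InnerProductSpace ℂ E]

/-- If Bessel's inequality is an equality at `x`, then `x` lies in the closed span of the
orthonormal family, hence is orthogonal to everything that the family is orthogonal to. -/
lemma Orthonormal.inner_eq_zero_of_tsum_eq {ι : Type*} {v : ι → E} (hv : Orthonormal ℂ v)
    {x f : E} (hx : ∑' i, ‖inner ℂ (v i) x‖ ^ 2 = ‖x‖ ^ 2) (hf : ∀ i, inner ℂ (v i) f = 0) :
    inner ℂ f x = 0 := by
  -- Bessel's inequality at `x - c • f` says that `x` is the point of `x + ℂ f` of least norm.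
  have hmin : ∀ c : ℂ, ‖x‖ ^ 2 ≤ ‖x - c • f‖ ^ 2 := by
    intro c
    have h := hv.tsum_inner_products_le (x - c • f)
    simpa [inner_sub_right, inner_smul_right, hf, hx] using h
  by_contra hne
  have hf0 : f ≠ 0 := by
    rintro rfl
    simp at hne
  have hfn : (0 : ℝ) < ‖f‖ ^ 2 := by positivity
  set z : ℂ := inner ℂ f x with hz
  have h := hmin (z / (‖f‖ ^ 2 : ℝ))
  rw [norm_sub_sq (𝕜 := ℂ), inner_smul_right, norm_smul, ← inner_conj_symm, ← hz, norm_div,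
    div_mul_eq_mul_div, Complex.mul_conj, Complex.norm_real, Complex.normSq_eq_norm_sq,
    ← Complex.ofReal_div] at h
  simp only [RCLike.re_to_complex, Complex.ofReal_re, norm_pow, norm_norm] at h
  have hzn : (0 : ℝ) < ‖z‖ ^ 2 := by positivity
  have : (‖z‖ / ‖f‖ ^ 2 * ‖f‖) ^ 2 = ‖z‖ ^ 2 / ‖f‖ ^ 2 := by
    field_simp
  have h3 : 0 < ‖z‖ ^ 2 / ‖f‖ ^ 2 := by positivity
  linarith

end Hilbert

section ExpL2

variable {V : Type*} [NormedAddCommGroup V] [InnerProductSpace ℝ V] [FiniteDimensional ℝ V]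
  [MeasurableSpace V] [BorelSpace V] {S : Set V}

/-- The exponential of frequency `ξ` as an element of `L²(S)`. -/
def expL2 (S : Set V) [IsFiniteMeasure (volume.restrict S)] (ξ : V) :
    Lp ℂ 2 (volume.restrict S) :=
  (memLp_expFun ξ 2).toLp

/-- Two exponentials are orthogonal in `L²(S)` if the transform of the indicator function of `S`
vanishes at the difference of the frequencies. -/
def OrthogonalOn {ι : Type*} (S : Set V) (w : ι → V) : Prop :=
  ∀ i j, i ≠ j → indFT S (w i - w j) = 0

lemma IsSpectrum.orthogonalOn {Λ : Set V} (h : IsSpectrum S Λ) :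
    OrthogonalOn S ((↑) : Λ → V) := by
  intro i j hij
  rw [← h.orthogonal i i.2 j j.2 (Subtype.coe_injective.ne hij)]
  simp only [expFun_mul_conj, indFT]

variable [IsFiniteMeasure (volume.restrict S)]

lemma inner_expL2_toLp (ξ : V) {f : V → ℂ} (hf : MemLp f 2 (volume.restrict S)) :
    inner ℂ (expL2 S ξ) hf.toLp = ∫ x in S, f x * conj (expFun ξ x) := by
  rw [L2.inner_def]
  refine integral_congr_ae ?_
  filter_upwards [hf.coeFn_toLp, (memLp_expFun (μ := volume.restrict S) ξ 2).coeFn_toLp]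
    with x h1 h2
  rw [h1, expL2, h2, RCLike.inner_apply]

lemma inner_expL2_expL2 (ξ η : V) : inner ℂ (expL2 S η) (expL2 S ξ) = indFT S (ξ - η) := by
  rw [expL2, expL2, ← expL2, inner_expL2_toLp]
  simp only [expFun_mul_conj, indFT]

lemma norm_expL2_sq (ξ : V) : ‖expL2 S ξ‖ ^ 2 = volume.real S := by
  have h := inner_self_eq_norm_sq_to_K (𝕜 := ℂ) (expL2 S ξ)
  rw [inner_expL2_expL2, sub_self, indFT_zero] at h
  refine Complex.ofReal_injective ?_
  rw [Complex.ofReal_pow]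
  exact h.symm

/-- The exponentials, normalized in `L²(S)`. -/
def unitExpL2 (S : Set V) [IsFiniteMeasure (volume.restrict S)] (ξ : V) :
    Lp ℂ 2 (volume.restrict S) :=
  ((√(volume.real S))⁻¹ : ℂ) • expL2 S ξ

lemma orthonormal_unitExpL2 (hS : 0 < volume.real S) {ι : Type*} {w : ι → V}
    (hw : OrthogonalOn S w) : Orthonormal ℂ fun i => unitExpL2 S (w i) := by
  refine ⟨fun i => ?_, fun i j hij => ?_⟩
  · have h : ‖expL2 S (w i)‖ = √(volume.real S) := by
      rw [← norm_expL2_sq (w i), Real.sqrt_sq (norm_nonneg _)]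
    have h0 : √(volume.real S) ≠ 0 := by positivity
    rw [show ‖(fun i => unitExpL2 S (w i)) i‖ = ‖unitExpL2 S (w i)‖ from rfl, unitExpL2, norm_smul,
      h, norm_inv, Complex.norm_real, Real.norm_eq_abs,
      abs_of_nonneg (Real.sqrt_nonneg _), inv_mul_cancel₀ h0]
  · simp only [unitExpL2]
    rw [inner_smul_left, inner_smul_right, inner_expL2_expL2, hw j i hij.symm]
    simp

lemma norm_inner_unitExpL2_sq (ξ η : V) :
    ‖inner ℂ (unitExpL2 S η) (expL2 S ξ)‖ ^ 2 = (volume.real S)⁻¹ * ‖indFT S (ξ - η)‖ ^ 2 := by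
  rw [unitExpL2, inner_smul_left, inner_expL2_expL2, norm_mul, mul_pow]
  simp [Real.sq_sqrt measureReal_nonneg]

/-- Bessel's inequality for exponentials. -/
lemma tsum_enorm_indFT_sq_le (hS : 0 < volume.real S) {ι : Type*} {w : ι → V}
    (hw : OrthogonalOn S w) (y : V) :
    ∑' i, ‖indFT S (y - w i)‖ₑ ^ 2 ≤ volume S ^ 2 := by
  have hfin : volume S ≠ ∞ := by
    simpa using measure_ne_top (volume.restrict S) Set.univ
  refine ENNReal.summable.tsum_le_of_sum_le fun F => ?_
  have h := (orthonormal_unitExpL2 hS hw).sum_inner_products_le (expL2 S y) (s := F)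
  simp only [norm_inner_unitExpL2_sq, norm_expL2_sq, ← Finset.mul_sum] at h
  rw [inv_mul_le_iff₀ hS, ← sq] at h
  rw [← ENNReal.ofReal_toReal hfin, ← ENNReal.ofReal_pow ENNReal.toReal_nonneg]
  refine le_trans (le_of_eq ?_) (ENNReal.ofReal_le_ofReal h)
  rw [ENNReal.ofReal_sum_of_nonneg fun _ _ => by positivity]
  refine Finset.sum_congr rfl fun i _ => ?_
  rw [ENNReal.ofReal_pow (norm_nonneg _), ofReal_norm]

/-- Parseval's identity for a spectrum. -/
lemma IsSpectrum.tsum_enorm_indFT_sq {Λ : Set V} (h : IsSpectrum S Λ) (hS : 0 < volume.real S)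
    (y : V) : ∑' i : Λ, ‖indFT S (y - i)‖ₑ ^ 2 = volume S ^ 2 := by
  have hfin : volume S ≠ ∞ := by
    simpa using measure_ne_top (volume.restrict S) Set.univ
  have hw := h.orthogonalOn
  have hv := orthonormal_unitExpL2 hS hw
  have hbot : (Submodule.span ℂ (Set.range fun i : Λ => unitExpL2 S (i : V)))ᗮ = ⊥ := by
    rw [Submodule.eq_bot_iff]
    intro f hf
    have hf' : ∀ i : Λ, ∫ x in S, f x * conj (expFun (i : V) x) = 0 := by
      intro i
      have h1 := (Submodule.mem_orthogonal _ _).1 hf _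
        (Submodule.subset_span (Set.mem_range_self i))
      have h0 : √(volume.real S) ≠ 0 := by positivity
      rw [unitExpL2, inner_smul_left] at h1
      have h2 := (mul_eq_zero.1 h1).resolve_left (by simpa using h0)
      rw [← inner_expL2_toLp _ (Lp.memLp f), Lp.toLp_coeFn, h2]
    have := h.complete f (Lp.memLp f) fun ξ hξ => hf' ⟨ξ, hξ⟩
    exact (Lp.eq_zero_iff_ae_eq_zero).2 this
  have hsum := (HilbertBasis.mkOfOrthogonalEqBot hv hbot).hasSum_inner_mul_inner
    (expL2 S y) (expL2 S y)
  have hs : HasSum (fun i : Λ => ‖indFT S (y - i)‖ ^ 2) (volume.real S ^ 2) := by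
    have e : ∀ i : Λ, inner ℂ (expL2 S y) (unitExpL2 S (i : V)) *
        inner ℂ (unitExpL2 S (i : V)) (expL2 S y) =
        (((volume.real S)⁻¹ * ‖indFT S (y - i)‖ ^ 2 : ℝ) : ℂ) := by
      intro i
      rw [← norm_inner_unitExpL2_sq, ← inner_conj_symm, mul_comm, Complex.mul_conj,
        Complex.normSq_eq_norm_sq]
    simp only [HilbertBasis.coe_mkOfOrthogonalEqBot, e, inner_expL2_expL2, sub_self,
      indFT_zero] at hsum
    have h3 := (Complex.hasSum_ofReal.1 hsum).mul_left (volume.real S)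
    simpa [mul_inv_cancel_left₀ hS.ne', sq] using h3
  rw [← ENNReal.ofReal_toReal hfin, ← ENNReal.ofReal_pow ENNReal.toReal_nonneg]
  change _ = ENNReal.ofReal (volume.real S ^ 2)
  rw [← hs.tsum_eq, ENNReal.ofReal_tsum_of_nonneg (fun _ => by positivity) hs.summable]
  refine tsum_congr fun i => ?_
  rw [ENNReal.ofReal_pow (norm_nonneg _), ofReal_norm]

/-- An orthogonal family of exponentials for which Bessel's inequality is an equality at almost
every frequency is complete. -/
lemma isSpectrum_range_of_ae_tsum_eq (hSm : MeasurableSet S) (hS : 0 < volume.real S)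
    {ι : Type*} {w : ι → V} (hw : OrthogonalOn S w)
    (h : ∀ᵐ y, ∑' i, ‖indFT S (y - w i)‖ₑ ^ 2 = volume S ^ 2) :
    IsSpectrum S (Set.range w) := by
  have hfin : volume S ≠ ∞ := by
    simpa using measure_ne_top (volume.restrict S) Set.univ
  refine ⟨fun ξ _ => memLp_expFun ξ 2, ?_, fun f hf hf0 => ?_⟩
  · rintro _ ⟨i, rfl⟩ _ ⟨j, rfl⟩ hij
    simp only [expFun_mul_conj]
    exact hw i j fun h => hij (by rw [h])
  refine ae_eq_zero_of_setIntegral_conj_expFun hSm hfin hf ?_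
  filter_upwards [h] with y hy
  rw [← inner_expL2_toLp y hf, ← inner_conj_symm, map_eq_zero]
  refine (orthonormal_unitExpL2 hS hw).inner_eq_zero_of_tsum_eq ?_ fun i => ?_
  · simp only [norm_inner_unitExpL2_sq, norm_expL2_sq, tsum_mul_left]
    have e : ∑' i, ‖indFT S (y - w i)‖ ^ 2 = volume.real S ^ 2 := by
      rw [Measure.real, ← ENNReal.toReal_pow, ← hy, ENNReal.tsum_toReal_eq]
      · simp
      · simp
    rw [e]
    field_simp
  · rw [unitExpL2, inner_smul_left, inner_expL2_toLp, hf0 _ ⟨i, rfl⟩, mul_zero]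

/-- An orthogonal family of exponentials is uniformly separated, hence countable. -/
lemma OrthogonalOn.countable (hS : 0 < volume.real S) {ι : Type*} {w : ι → V}
    (hw : OrthogonalOn S w) : Countable ι := by
  have hfin : volume S ≠ ∞ := by
    simpa using measure_ne_top (volume.restrict S) Set.univ
  have h0 : {ξ | indFT S ξ ≠ 0} ∈ nhds (0 : V) :=
    (isOpen_ne_fun (continuous_indFT hfin) continuous_const).mem_nhds
      (by simpa [indFT_zero] using hS.ne')
  obtain ⟨r, hr, hball⟩ := Metric.mem_nhds_iff.1 h0
  refine Pairwise.countable_of_isOpen_disjoint (s := fun i => Metric.ball (w i) (r / 2))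
    (fun i j hij => ?_) (fun i => Metric.isOpen_ball)
    (fun i => Metric.nonempty_ball.2 (half_pos hr))
  refine Metric.ball_disjoint_ball ?_
  by_contra! hlt
  have hmem : w i - w j ∈ Metric.ball (0 : V) r := by
    rw [mem_ball_zero_iff, ← dist_eq_norm]
    linarith
  exact hball hmem (hw i j hij)

end ExpL2

/-! ### Packing against tiling -/

section Packing

variable {U : Type*} [AddCommGroup U] [MeasurableSpace U] [MeasurableAdd₂ U] [MeasurableNeg U]
  {μ : Measure U} [μ.IsAddLeftInvariant]
  {ι : Type*} [Countable ι] {q : ι → U} {F g : U → ℝ≥0∞} {c d : ℝ≥0∞}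

/-- Convolving a sum of translates of `g` with `F` convolves the sum of the same translates of `F`,
here a constant, with `g`. -/
lemma lintegral_mul_tsum_translate (hF : Measurable F) (hg : Measurable g)
    (hc : ∀ z, ∑' i, F (z - q i) = c) (z₀ : U) :
    ∫⁻ z, F (z₀ - z) * ∑' i, g (z - q i) ∂μ = c * ∫⁻ z, g z ∂μ := by
  have hF' : ∀ u : U, Measurable fun z => F (u - z) := fun u =>
    hF.comp (measurable_const.sub measurable_id)
  have hg' : ∀ u : U, Measurable fun z => g (z - u) := fun u =>
    hg.comp (measurable_id.sub measurable_const)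
  calc ∫⁻ z, F (z₀ - z) * ∑' i, g (z - q i) ∂μ
      = ∑' i, ∫⁻ z, F (z₀ - z) * g (z - q i) ∂μ := by
        simp only [← ENNReal.tsum_mul_left]
        exact lintegral_tsum fun i => ((hF' _).mul (hg' _)).aemeasurable
    _ = ∑' i, ∫⁻ z, F (z₀ - z - q i) * g z ∂μ := by
        refine tsum_congr fun i => ?_
        rw [← lintegral_sub_right_eq_self (fun z => F (z₀ - z - q i) * g z) (q i)]
        refine lintegral_congr fun z => ?_
        congr 2
        abel
    _ = ∫⁻ z, (∑' i, F (z₀ - z - q i)) * g z ∂μ := by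
        simp only [← ENNReal.tsum_mul_right]
        refine (lintegral_tsum fun i => ?_).symm
        refine Measurable.aemeasurable (Measurable.mul ?_ hg)
        simpa only [sub_right_comm] using hF' (z₀ - q i)
    _ = c * ∫⁻ z, g z ∂μ := by
        simp only [hc]
        exact lintegral_const_mul _ hg

variable [μ.IsNegInvariant]

/-- Packing and tiling by the same translates: in proportion to the level, the mass of the packing
is at most that of the tiling. -/
lemma lintegral_packing_le_tiling (hF : Measurable F) (hg : Measurable g)
    (hc : ∀ z, ∑' i, F (z - q i) = c) (hd : ∀ z, ∑' i, g (z - q i) ≤ d) :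
    c * ∫⁻ z, g z ∂μ ≤ d * ∫⁻ z, F z ∂μ := by
  rw [← lintegral_mul_tsum_translate hF hg hc 0]
  calc ∫⁻ z, F (0 - z) * ∑' i, g (z - q i) ∂μ ≤ ∫⁻ z, F (0 - z) * d ∂μ :=
        lintegral_mono fun z => mul_le_mul_right (hd z) _
    _ = d * ∫⁻ z, F z ∂μ := by
        have hF' : Measurable fun z => F (0 - z) := hF.comp (measurable_const.sub measurable_id)
        rw [lintegral_mul_const _ hF', mul_comm, lintegral_sub_left_eq_self F 0]

variable [TopologicalSpace U] [IsTopologicalAddGroup U] [TopologicalSpace.SeparableSpace U]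

/-- A packing whose mass equals that of a tiling by the same translates is a tiling. -/
lemma ae_tsum_packing_eq (hF : Measurable F) (hFc : Continuous F) (hF0 : F 0 ≠ 0)
    (hg : Measurable g) (hc : ∀ z, ∑' i, F (z - q i) = c) (hd : ∀ z, ∑' i, g (z - q i) ≤ d)
    (hfin : d * ∫⁻ z, F z ∂μ ≠ ∞) (heq : c * ∫⁻ z, g z ∂μ = d * ∫⁻ z, F z ∂μ) :
    ∀ᵐ z ∂μ, ∑' i, g (z - q i) = d := by
  have hFm : ∀ z₀ : U, Measurable fun z => F (z₀ - z) := fun z₀ =>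
    hF.comp (measurable_const.sub measurable_id)
  have hgm : Measurable fun z => ∑' i, g (z - q i) :=
    Measurable.tsum fun i => hg.comp (measurable_id.sub measurable_const)
  have hpoint : ∀ z₀ : U, ∀ᵐ z ∂μ, F (z₀ - z) * ∑' i, g (z - q i) = F (z₀ - z) * d := by
    intro z₀
    refine ae_eq_of_ae_le_of_lintegral_le (.of_forall fun z => mul_le_mul_right (hd z) _) ?_
      ((hFm z₀).mul_const d).aemeasurable ?_
    · rw [lintegral_mul_tsum_translate hF hg hc, heq]
      exact hfin
    · rw [lintegral_mul_tsum_translate hF hg hc, heq, lintegral_mul_const _ (hFm z₀), mul_comm,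
        lintegral_sub_left_eq_self F z₀]
  have hFint : ∀ᵐ z ∂μ, d = 0 ∨ ∀ n : ℕ, F (TopologicalSpace.denseSeq U n - z) ≠ ∞ := by
    rcases eq_or_ne d 0 with h0 | h0
    · exact .of_forall fun z => .inl h0
    have hFfin : ∫⁻ z, F z ∂μ ≠ ∞ := fun h => hfin (by rw [h, ENNReal.mul_top h0])
    have : ∀ n : ℕ, ∀ᵐ z ∂μ, F (TopologicalSpace.denseSeq U n - z) ≠ ∞ := fun n => by
      refine (ae_lt_top (hFm _) ?_).mono fun z hz => hz.ne
      rwa [lintegral_sub_left_eq_self F]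
    filter_upwards [ae_all_iff.2 this] with z hz using .inr hz
  filter_upwards [ae_all_iff.2 fun n => hpoint (TopologicalSpace.denseSeq U n), hFint] with z hz hz'
  rcases hz' with h0 | hz'
  · exact le_antisymm (hd z) (h0.le.trans zero_le)
  -- `F` does not vanish near `0`, hence not at `zₙ - z` for some `zₙ` of the dense sequence.
  have hopen : IsOpen {u : U | F (u - z) ≠ 0} :=
    isOpen_ne_fun (hFc.comp (continuous_id.sub continuous_const)) continuous_const
  obtain ⟨n, hn⟩ := (TopologicalSpace.denseRange_denseSeq U).exists_mem_open hopen
    ⟨z, by simpa using hF0⟩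
  exact (ENNReal.mul_right_inj hn (hz' n)).1 (hz n)

end Packing

/-! ### Product domains -/

section Product

variable {W : Type*} [NormedAddCommGroup W] [InnerProductSpace ℝ W] [FiniteDimensional ℝ W]
  [MeasurableSpace W] [BorelSpace W]

/-- If no nonzero difference of elements of `T` is a zero of the transform of `A`, then
`|A| |T| ≤ 1`, and in the case of equality the frequencies with first coordinate in a translate of
`-T` give a spectrum of `B`. Of the spectrum `{(p i, w i)}` of `A × B`, only Parseval's identity
and the orthogonality are needed. -/
theorem volume_mul_le_one_and_isSpectral {A T : Set ℝ} {B : Set W} {ι : Type*} [Countable ι]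
    {p : ι → ℝ} {w : ι → W} (hAm : MeasurableSet A) (hA : volume A ≠ ∞) (hA0 : volume A ≠ 0)
    (hBm : MeasurableSet B) (hB : volume B ≠ ∞) (hB0 : volume B ≠ 0)
    (hpar : ∀ x y, ∑' i, ‖indFT A (x - p i)‖ₑ ^ 2 * ‖indFT B (y - w i)‖ₑ ^ 2 =
      (volume A * volume B) ^ 2)
    (horth : ∀ i j, i ≠ j → indFT A (p i - p j) = 0 ∨ indFT B (w i - w j) = 0)
    (hTm : MeasurableSet T) (hT : ∀ s ∈ T, ∀ t ∈ T, s ≠ t → indFT A (s - t) ≠ 0) :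
    volume A * volume T ≤ 1 ∧ (volume A * volume T = 1 → IsSpectral B) := by
  have hBfin : IsFiniteMeasure (volume.restrict B) := ⟨by simpa using hB.lt_top⟩
  have hBr : 0 < volume.real B := ENNReal.toReal_pos hB0 hB
  have hw : ∀ x : ℝ, OrthogonalOn B fun i : {i | x - p i ∈ T} => w i := by
    intro x i j hij
    refine (horth i j (Subtype.coe_injective.ne hij)).resolve_left ?_
    have e : p i - p j = (x - p j) - (x - p i) := by ring
    rw [e]
    by_cases h : x - p j = x - p i
    · rw [h, sub_self, indFT_zero]
      exact_mod_cast (ENNReal.toReal_pos hA0 hA).ne'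
    · exact hT _ j.2 _ i.2 h
  set F : ℝ × W → ℝ≥0∞ := fun z => ‖indFT A z.1‖ₑ ^ 2 * ‖indFT B z.2‖ₑ ^ 2 with hF
  set g : ℝ × W → ℝ≥0∞ := fun z => T.indicator 1 z.1 * ‖indFT B z.2‖ₑ ^ 2 with hg
  have mA : Measurable fun x => ‖indFT A x‖ₑ ^ 2 :=
    (continuous_indFT hA).measurable.enorm.pow_const 2
  have mB : Measurable fun y => ‖indFT B y‖ₑ ^ 2 :=
    (continuous_indFT hB).measurable.enorm.pow_const 2
  have mT : Measurable (T.indicator (1 : ℝ → ℝ≥0∞)) := measurable_one.indicator hTm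
  have mF : Measurable F := (mA.comp measurable_fst).mul (mB.comp measurable_snd)
  have mg : Measurable g := (mT.comp measurable_fst).mul (mB.comp measurable_snd)
  have iF : ∫⁻ z, F z = volume A * volume B := by
    rw [← lintegral_enorm_indFT_sq hAm hA, ← lintegral_enorm_indFT_sq hBm hB]
    exact lintegral_prod_mul mA.aemeasurable mB.aemeasurable
  have ig : ∫⁻ z, g z = volume T * volume B := by
    rw [← lintegral_indicator_one hTm, ← lintegral_enorm_indFT_sq hBm hB]
    exact lintegral_prod_mul mT.aemeasurable mB.aemeasurable
  have hc : ∀ z, ∑' i, F (z - (p i, w i)) = (volume A * volume B) ^ 2 := fun z => hpar z.1 z.2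
  have hsum : ∀ z : ℝ × W, ∑' i, g (z - (p i, w i)) =
      ∑' i : {i | z.1 - p i ∈ T}, ‖indFT B (z.2 - w i)‖ₑ ^ 2 := by
    intro z
    rw [tsum_subtype {i | z.1 - p i ∈ T} fun i => ‖indFT B (z.2 - w i)‖ₑ ^ 2]
    refine tsum_congr fun i => ?_
    by_cases h : z.1 - p i ∈ T <;> simp [hg, h]
  have hd : ∀ z, ∑' i, g (z - (p i, w i)) ≤ volume B ^ 2 := by
    intro z
    rw [hsum]
    exact tsum_enorm_indFT_sq_le hBr (hw z.1) z.2
  have : (volume : Measure (ℝ × W)).IsAddLeftInvariant :=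
    inferInstanceAs ((volume : Measure ℝ).prod (volume : Measure W)).IsAddLeftInvariant
  have : (volume : Measure (ℝ × W)).IsNegInvariant :=
    ⟨((Measure.measurePreserving_neg (volume : Measure ℝ)).prod
      (Measure.measurePreserving_neg (volume : Measure W))).map_eq⟩
  have hle := lintegral_packing_le_tiling (μ := volume) mF mg hc hd
  have eL : (volume A * volume B) ^ 2 * ∫⁻ z, g z =
      volume A * volume T * (volume A * volume B ^ 3) := by
    rw [ig]
    ring
  have eR : volume B ^ 2 * ∫⁻ z, F z = 1 * (volume A * volume B ^ 3) := by
    rw [iF]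
    ring
  have hne0 : volume A * volume B ^ 3 ≠ 0 := mul_ne_zero hA0 (pow_ne_zero _ hB0)
  have hneT : volume A * volume B ^ 3 ≠ ∞ := by finiteness
  refine ⟨?_, fun h1 => ?_⟩
  · rw [eL, eR] at hle
    exact (ENNReal.mul_le_mul_iff_left hne0 hneT).1 hle
  have hFc : Continuous F := by
    have cA : Continuous fun x => ‖indFT A x‖ₑ ^ 2 :=
      (ENNReal.continuous_pow 2).comp (continuous_indFT hA).enorm
    have cB : Continuous fun y => ‖indFT B y‖ₑ ^ 2 :=
      (ENNReal.continuous_pow 2).comp (continuous_indFT hB).enorm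
    refine continuous_iff_continuousAt.2 fun z => ?_
    exact ENNReal.Tendsto.mul (cA.comp continuous_fst).continuousAt (.inr (by simp))
      (cB.comp continuous_snd).continuousAt (.inr (by simp))
  have hF0 : F 0 ≠ 0 := by
    have hAr : volume.real A ≠ 0 := (ENNReal.toReal_pos hA0 hA).ne'
    simp [hF, indFT_zero, hAr, hBr.ne']
  have hae := ae_tsum_packing_eq (μ := volume) mF hFc hF0 mg hc hd (by rw [eR, one_mul]; exact hneT)
    (by rw [eL, eR, h1])
  obtain ⟨x, hx⟩ := (Measure.ae_ae_of_ae_prod hae).exists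
  refine ⟨_, isSpectrum_range_of_ae_tsum_eq hBm hBr (hw x) ?_⟩
  filter_upwards [hx] with y hy
  rw [← hy, hsum]

end Product

section Cylinder

variable {n : ℕ}

/-- The first coordinate and the vector of the remaining ones. -/
def headTail (x : EuclideanSpace ℝ (Fin (n + 1))) : ℝ × EuclideanSpace ℝ (Fin n) :=
  (x 0, WithLp.toLp 2 fun i => x i.succ)

lemma cylinderSet_eq_preimage (A : Set ℝ) (B : Set (EuclideanSpace ℝ (Fin n))) :
    cylinderSet A B = headTail ⁻¹' (A ×ˢ B) := rfl

lemma headTail_surjective : Function.Surjective (headTail (n := n)) := fun z =>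
  ⟨WithLp.toLp 2 (Fin.cons z.1 z.2), rfl⟩

lemma headTail_sub (x y : EuclideanSpace ℝ (Fin (n + 1))) :
    headTail (x - y) = headTail x - headTail y := rfl

lemma measurePreserving_headTail :
    MeasurePreserving (headTail (n := n)) volume volume := by
  have h := ((MeasurePreserving.id (volume : Measure ℝ)).prod
    (PiLp.volume_preserving_toLp (Fin n))).comp
    ((volume_preserving_piFinSuccAbove (fun _ : Fin (n + 1) => ℝ) 0).comp
      (EuclideanSpace.volume_preserving_symm_measurableEquiv_toLp (Fin (n + 1))))
  exact h

lemma measurableEmbedding_headTail : MeasurableEmbedding (headTail (n := n)) :=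
  ((MeasurableEquiv.toLp 2 (Fin (n + 1) → ℝ)).symm.trans
    ((MeasurableEquiv.piFinSuccAbove (fun _ : Fin (n + 1) => ℝ) 0).trans
      ((MeasurableEquiv.refl ℝ).prodCongr (MeasurableEquiv.toLp 2 _)))).measurableEmbedding

lemma expFun_headTail (ξ x : EuclideanSpace ℝ (Fin (n + 1))) :
    expFun ξ x = expFun (headTail ξ).1 (headTail x).1 * expFun (headTail ξ).2 (headTail x).2 := by
  simp only [expFun, ← Complex.exp_add, headTail]
  rw [PiLp.inner_apply, Fin.sum_univ_succ, PiLp.inner_apply]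
  congr 1
  push_cast
  ring

lemma volume_cylinderSet (A : Set ℝ) (B : Set (EuclideanSpace ℝ (Fin n))) :
    volume (cylinderSet A B) = volume A * volume B := by
  rw [cylinderSet_eq_preimage, measurePreserving_headTail.measure_preimage_emb
    measurableEmbedding_headTail, Measure.volume_eq_prod, Measure.prod_prod]

lemma indFT_cylinderSet (A : Set ℝ) (B : Set (EuclideanSpace ℝ (Fin n)))
    (ξ : EuclideanSpace ℝ (Fin (n + 1))) :
    indFT (cylinderSet A B) ξ = indFT A (headTail ξ).1 * indFT B (headTail ξ).2 := by
  simp only [indFT, expFun_headTail]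
  rw [cylinderSet_eq_preimage, measurePreserving_headTail.setIntegral_preimage_emb
    measurableEmbedding_headTail (fun z => expFun (headTail ξ).1 z.1 * expFun (headTail ξ).2 z.2),
    Measure.volume_eq_prod, setIntegral_prod_mul]

/-- The density bound for a spectral cylinder. -/
theorem volume_mul_le_one_of_isSpectral_cylinderSet {A T : Set ℝ}
    {B : Set (EuclideanSpace ℝ (Fin n))} (hAm : MeasurableSet A) (hA : volume A ≠ ∞)
    (hA0 : volume A ≠ 0) (hBm : MeasurableSet B) (hB : volume B ≠ ∞) (hB0 : volume B ≠ 0)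
    (hspec : IsSpectral (cylinderSet A B))
    (hTm : MeasurableSet T) (hT : ∀ s ∈ T, ∀ t ∈ T, s ≠ t → indFT A (s - t) ≠ 0) :
    volume A * volume T ≤ 1 ∧ (volume A * volume T = 1 → IsSpectral B) := by
  obtain ⟨Λ, hΛ⟩ := hspec
  have hvol := volume_cylinderSet A B
  have hfin : volume (cylinderSet A B) ≠ ∞ := hvol ▸ ENNReal.mul_ne_top hA hB
  have hpos : 0 < volume.real (cylinderSet A B) :=
    ENNReal.toReal_pos (hvol ▸ mul_ne_zero hA0 hB0) hfin
  have : IsFiniteMeasure (volume.restrict (cylinderSet A B)) := ⟨by simpa using hfin.lt_top⟩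
  have horth : OrthogonalOn (cylinderSet A B) ((↑) : Λ → EuclideanSpace ℝ (Fin (n + 1))) :=
    hΛ.orthogonalOn
  have := horth.countable hpos
  refine volume_mul_le_one_and_isSpectral (ι := Λ) (p := fun i => (headTail i.1).1)
    (w := fun i => (headTail i.1).2) hAm hA hA0 hBm hB hB0 (fun x y => ?_) (fun i j hij => ?_)
    hTm hT
  · obtain ⟨z, hz⟩ := headTail_surjective (x, y)
    rw [← hvol, ← hΛ.tsum_enorm_indFT_sq hpos z]
    refine tsum_congr fun i => ?_
    rw [indFT_cylinderSet, headTail_sub, hz, enorm_mul, mul_pow]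
    rfl
  · have h := horth i j hij
    rwa [indFT_cylinderSet, headTail_sub, mul_eq_zero] at h

end Cylinder

/-! ### Zeros of the transform of two intervals -/

section Zeros

lemma expFun_real (ξ x : ℝ) :
    expFun ξ x = Complex.exp (2 * Real.pi * Complex.I * (ξ * x : ℝ)) := by
  simp [expFun, mul_comm]

lemma expFun_eq_expFun_iff {ξ x y : ℝ} :
    expFun ξ x = expFun ξ y ↔ ∃ k : ℤ, ξ * (x - y) = k := by
  have h0 := Complex.two_pi_I_ne_zero
  rw [expFun_real, expFun_real, Complex.exp_eq_exp_iff_exists_int]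
  refine exists_congr fun k => ?_
  constructor
  · intro h
    have h1 : 2 * Real.pi * Complex.I * ((ξ * (x - y) : ℝ) : ℂ) =
        2 * Real.pi * Complex.I * k := by
      push_cast at h ⊢
      linear_combination h
    exact_mod_cast mul_left_cancel₀ h0 h1
  · intro h
    have h1 : ((ξ * (x - y) : ℝ) : ℂ) = (k : ℂ) := by exact_mod_cast congrArg Complex.ofReal h
    push_cast at h1 ⊢
    linear_combination (2 * Real.pi * Complex.I) * h1

lemma expFun_eq_one_iff {ξ x : ℝ} : expFun ξ x = 1 ↔ ∃ k : ℤ, ξ * x = k := by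
  have h := expFun_eq_expFun_iff (ξ := ξ) (x := x) (y := 0)
  simpa [expFun_real] using h

lemma expFun_eq_neg_expFun_iff {ξ x y : ℝ} :
    expFun ξ x = -expFun ξ y ↔ ∃ k : ℤ, ξ * (x - y) = k + 1 / 2 := by
  have h0 := Complex.two_pi_I_ne_zero
  have hneg : -expFun ξ y = Complex.exp (2 * Real.pi * Complex.I * (ξ * y : ℝ) +
      Real.pi * Complex.I) := by
    rw [Complex.exp_add, Complex.exp_pi_mul_I, expFun_real, mul_neg_one]
  rw [hneg, expFun_real, Complex.exp_eq_exp_iff_exists_int]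
  refine exists_congr fun k => ?_
  constructor
  · intro h
    have h1 : 2 * Real.pi * Complex.I * ((ξ * (x - y) : ℝ) : ℂ) =
        2 * Real.pi * Complex.I * ((k + 1 / 2 : ℝ) : ℂ) := by
      push_cast at h ⊢
      linear_combination h
    exact_mod_cast mul_left_cancel₀ h0 h1
  · intro h
    have h1 : ((ξ * (x - y) : ℝ) : ℂ) = ((k + 1 / 2 : ℝ) : ℂ) := congrArg Complex.ofReal h
    push_cast at h1 ⊢
    linear_combination (2 * Real.pi * Complex.I) * h1

lemma two_pi_I_mul_indFT_Ioc {a b : ℝ} (hab : a ≤ b) {ξ : ℝ} (hξ : ξ ≠ 0) :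
    2 * Real.pi * Complex.I * ξ * indFT (Set.Ioc a b) ξ = expFun ξ b - expFun ξ a := by
  have hc : 2 * Real.pi * Complex.I * (ξ : ℂ) ≠ 0 :=
    mul_ne_zero Complex.two_pi_I_ne_zero (by exact_mod_cast hξ)
  have e : ∀ x : ℝ, expFun ξ x = Complex.exp (2 * Real.pi * Complex.I * ξ * x) := by
    intro x
    rw [expFun_real]
    push_cast
    ring_nf
  simp only [indFT, e]
  rw [← intervalIntegral.integral_of_le hab, integral_exp_mul_complex hc, mul_div_cancel₀ _ hc]

variable {a b c d : ℝ}

lemma disjoint_Ioc_Ioc (hbc : b ≤ c) : Disjoint (Set.Ioc a b) (Set.Ioc c d) :=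
  Set.disjoint_left.2 fun _ hx hy => (hx.2.trans hbc).not_gt hy.1

lemma volume_Ioc_union_Ioc (hab : a ≤ b) (hbc : b ≤ c) (hcd : c ≤ d) :
    volume (Set.Ioc a b ∪ Set.Ioc c d) = ENNReal.ofReal ((b - a) + (d - c)) := by
  rw [measure_union (disjoint_Ioc_Ioc hbc) measurableSet_Ioc, Real.volume_Ioc, Real.volume_Ioc,
    ENNReal.ofReal_add (by linarith) (by linarith)]

lemma isFiniteMeasure_restrict_Ioc_union_Ioc :
    IsFiniteMeasure (volume.restrict (Set.Ioc a b ∪ Set.Ioc c d)) :=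
  ⟨by simp⟩

lemma indFT_Ioc_union_Ioc (hbc : b ≤ c) (ξ : ℝ) :
    indFT (Set.Ioc a b ∪ Set.Ioc c d) ξ = indFT (Set.Ioc a b) ξ + indFT (Set.Ioc c d) ξ :=
  setIntegral_union (disjoint_Ioc_Ioc hbc) measurableSet_Ioc
    ((memLp_expFun ξ 1).integrable le_rfl) ((memLp_expFun ξ 1).integrable le_rfl)

lemma indFT_Ioc_union_Ioc_eq_zero_iff (hab : a ≤ b) (hbc : b ≤ c) (hcd : c ≤ d) {ξ : ℝ}
    (hξ : ξ ≠ 0) : indFT (Set.Ioc a b ∪ Set.Ioc c d) ξ = 0 ↔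
      expFun ξ b + expFun ξ d = expFun ξ a + expFun ξ c := by
  have hne : 2 * Real.pi * Complex.I * (ξ : ℂ) ≠ 0 :=
    mul_ne_zero Complex.two_pi_I_ne_zero (by exact_mod_cast hξ)
  rw [← mul_right_inj' hne, indFT_Ioc_union_Ioc hbc, mul_add, two_pi_I_mul_indFT_Ioc hab hξ,
    two_pi_I_mul_indFT_Ioc hcd hξ, mul_zero, ← sub_eq_zero (b := expFun ξ a + expFun ξ c)]
  ring_nf

/-- Two pairs of unit complex numbers with equal sums agree, unless both sums vanish. -/
lemma eq_or_eq_neg_of_add_eq_add {u v s t : ℂ} (hu : ‖u‖ = 1) (hv : ‖v‖ = 1) (hs : ‖s‖ = 1)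
    (ht : ‖t‖ = 1) (h : u + v = s + t) :
    (u = s ∧ v = t) ∨ (u = t ∧ v = s) ∨ (v = -u ∧ t = -s) := by
  have hne : ∀ z : ℂ, ‖z‖ = 1 → z ≠ 0 := by
    rintro z hz rfl
    simp at hz
  have hinv : u⁻¹ + v⁻¹ = s⁻¹ + t⁻¹ := by
    rw [Complex.inv_eq_conj hu, Complex.inv_eq_conj hv, Complex.inv_eq_conj hs,
      Complex.inv_eq_conj ht, ← map_add, ← map_add, h]
  have hu0 := hne u hu
  have hv0 := hne v hv
  have hs0 := hne s hs
  have ht0 := hne t ht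
  field_simp at hinv
  have hprod : (u + v) * (s * t - u * v) = 0 := by
    linear_combination hinv - u * v * h
  rcases mul_eq_zero.1 hprod with h1 | h1
  · refine .inr (.inr ⟨?_, ?_⟩)
    · linear_combination h1
    · linear_combination h1 - h
  · have h2 : (u - s) * (u - t) = 0 := by linear_combination h1 + u * h
    rcases mul_eq_zero.1 h2 with h3 | h3
    · exact .inl ⟨by linear_combination h3, by linear_combination h - h3⟩
    · exact .inr (.inl ⟨by linear_combination h3, by linear_combination h - h3⟩)

/-- At a zero `ξ` of the transform, the values of the exponential at the four endpoints cancel in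
pairs. -/
lemma exists_int_of_indFT_eq_zero (hab : a ≤ b) (hbc : b ≤ c) (hcd : c ≤ d) {ξ : ℝ}
    (hξ : ξ ≠ 0) (h : indFT (Set.Ioc a b ∪ Set.Ioc c d) ξ = 0) :
    ((∃ j : ℤ, ξ * (b - a) = j) ∧ ∃ k : ℤ, ξ * (d - c) = k) ∨
    ((∃ j : ℤ, ξ * (b - c) = j) ∧ ∃ k : ℤ, ξ * (d - a) = k) ∨
    ((∃ j : ℤ, ξ * (d - b) = j + 1 / 2) ∧ ∃ k : ℤ, ξ * (c - a) = k + 1 / 2) := by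
  simp only [← expFun_eq_expFun_iff, ← expFun_eq_neg_expFun_iff]
  exact eq_or_eq_neg_of_add_eq_add (norm_expFun _ _) (norm_expFun _ _) (norm_expFun _ _)
    (norm_expFun _ _) ((indFT_Ioc_union_Ioc_eq_zero_iff hab hbc hcd hξ).1 h)

end Zeros

/-! ### Spectra of two intervals -/

section Spectra

lemma IsSpectral.congr {V : Type*} [NormedAddCommGroup V] [InnerProductSpace ℝ V]
    [MeasureSpace V] {S S' : Set V} (h : S =ᵐ[volume] S') (hS : IsSpectral S) :
    IsSpectral S' := by
  obtain ⟨Λ, h1, h2, h3⟩ := hS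
  rw [Measure.restrict_congr_set h] at h1 h2 h3
  exact ⟨Λ, h1, h2, h3⟩

/-- Completeness of the Fourier series on `(a, b]`, with the frequencies translated by `θ`. -/
lemma ae_eq_zero_of_integral_conj_expFun {a b : ℝ} (hab : a < b) (θ : ℝ) {g : ℝ → ℂ}
    (hg : MemLp g 2) (hsupp : ∀ x, x ∉ Set.Ioc a b → g x = 0)
    (h : ∀ m : ℤ, ∫ x, g x * conj (expFun (m / (b - a) + θ) x) = 0) : g =ᵐ[volume] 0 := by
  set u : ℝ → ℂ := fun x => g x * conj (expFun θ x) with hu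
  have hnorm : ∀ x, ‖u x‖ = ‖g x‖ := fun x => by simp [hu]
  have huL : MemLp u 2 :=
    hg.congr_norm (hg.1.mul (continuous_expFun θ).star.aestronglyMeasurable)
      (.of_forall fun x => (hnorm x).symm)
  have hcoef : ∀ m : ℤ, fourierCoeffOn hab u m = 0 := by
    intro m
    rw [fourierCoeffOn_eq_integral, intervalIntegral.integral_of_le hab.le,
      setIntegral_eq_integral_of_forall_compl_eq_zero, ← smul_zero (1 / (b - a)), ← h m]
    · congr 2
      ext x
      rw [fourier_coe_apply, expFun_add_left, map_mul, conj_expFun, expFun_real, hu]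
      simp only [smul_eq_mul]
      have : Complex.exp (2 * Real.pi * Complex.I * ((-m : ℤ) : ℂ) * x / (b - a : ℝ)) =
          Complex.exp (2 * Real.pi * Complex.I * ((-(m / (b - a)) * x : ℝ) : ℂ)) := by
        congr 1
        push_cast
        ring
      rw [this]
      ring
    · intro x hx
      simp [hu, hsupp x hx]
  have hsum := hasSum_sq_fourierCoeffOn hab (huL.restrict _)
  simp only [hcoef, norm_zero, ne_eq, OfNat.ofNat_ne_zero, not_false_eq_true, zero_pow] at hsum
  have h0 := hasSum_zero.unique hsum
  have h1 : ∫ x in a..b, ‖u x‖ ^ 2 = 0 := by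
    have : b - a ≠ 0 := by linarith
    simpa [this] using h0.symm
  rw [intervalIntegral.integral_of_le hab.le, setIntegral_eq_integral_of_forall_compl_eq_zero
    (fun x hx => by simp [hu, hsupp x hx]), integral_eq_zero_iff_of_nonneg
    (fun x => by positivity) (huL.integrable_norm_pow two_ne_zero)] at h1
  filter_upwards [h1] with x hx
  have : ‖u x‖ = 0 := by simpa using hx
  rw [hnorm] at this
  simpa using this

variable {a b c d : ℝ} {f : ℝ → ℂ}

/-- The restriction of `f` to `(a, b]` plus `ζ` times its restriction to `(c, d]`, the latter
translated to the left by `s`. -/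
def foldFun (a b c d s : ℝ) (ζ : ℂ) (f : ℝ → ℂ) (x : ℝ) : ℂ :=
  (Set.Ioc a b).indicator f x + ζ * (Set.Ioc c d).indicator f (x + s)

lemma memLp_foldFun (hf : MemLp f 2 (volume.restrict (Set.Ioc a b ∪ Set.Ioc c d))) (s : ℝ)
    (ζ : ℂ) : MemLp (foldFun a b c d s ζ f) 2 := by
  have h1 : MemLp ((Set.Ioc a b).indicator f) 2 := (memLp_indicator_iff_restrict
    measurableSet_Ioc).2 (hf.mono_measure (Measure.restrict_mono_set _ Set.subset_union_left))
  have h2 : MemLp ((Set.Ioc c d).indicator f) 2 := (memLp_indicator_iff_restrict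
    measurableSet_Ioc).2 (hf.mono_measure (Measure.restrict_mono_set _ Set.subset_union_right))
  exact h1.add ((h2.comp_measurePreserving (measurePreserving_add_right volume s)).const_mul ζ)

lemma integral_foldFun (hbc : b ≤ c)
    (hf : MemLp f 2 (volume.restrict (Set.Ioc a b ∪ Set.Ioc c d))) {s ξ : ℝ} {ζ : ℂ}
    (hζ : ζ * expFun ξ s = 1) :
    ∫ x, foldFun a b c d s ζ f x * conj (expFun ξ x) =
      ∫ x in Set.Ioc a b ∪ Set.Ioc c d, f x * conj (expFun ξ x) := by
  have := isFiniteMeasure_restrict_Ioc_union_Ioc (a := a) (b := b) (c := c) (d := d)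
  set k : ℝ → ℂ := fun x => f x * conj (expFun ξ x) with hk
  have hki : Integrable k (volume.restrict (Set.Ioc a b ∪ Set.Ioc c d)) := by
    refine (hf.integrable one_le_two).mono
      (hf.1.mul (continuous_expFun ξ).star.aestronglyMeasurable) (.of_forall fun x => ?_)
    simp [hk]
  have h1 : Integrable ((Set.Ioc a b).indicator k) := (integrable_indicator_iff
    measurableSet_Ioc).2 (hki.mono_measure (Measure.restrict_mono_set _ Set.subset_union_left))
  have h2 : Integrable ((Set.Ioc c d).indicator k) := (integrable_indicator_iff
    measurableSet_Ioc).2 (hki.mono_measure (Measure.restrict_mono_set _ Set.subset_union_right))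
  have e : ∀ x, foldFun a b c d s ζ f x * conj (expFun ξ x) =
      (Set.Ioc a b).indicator k x + (Set.Ioc c d).indicator k (x + s) := by
    intro x
    have hc : conj (expFun ξ x) = expFun ξ s * conj (expFun ξ (x + s)) := by
      have h1 : expFun ξ s * conj (expFun ξ s) = 1 := by
        rw [expFun_mul_conj, sub_self, expFun_zero_left]
      rw [expFun_add_right, map_mul]
      linear_combination -conj (expFun ξ x) * h1
    rw [foldFun, add_mul]
    congr 1
    · by_cases hx : x ∈ Set.Ioc a b <;> simp [hx, hk]
    · by_cases hx : x + s ∈ Set.Ioc c d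
      · simp only [Set.indicator_of_mem hx, hk]
        rw [hc]
        linear_combination f (x + s) * conj (expFun ξ (x + s)) * hζ
      · simp [Set.indicator_of_notMem hx]
  simp only [e]
  rw [integral_add h1 (h2.comp_add_right s),
    integral_add_right_eq_self ((Set.Ioc c d).indicator k) s,
    integral_indicator measurableSet_Ioc, integral_indicator measurableSet_Ioc,
    setIntegral_union (disjoint_Ioc_Ioc hbc) measurableSet_Ioc
      (hki.mono_measure (Measure.restrict_mono_set _ Set.subset_union_left))
      (hki.mono_measure (Measure.restrict_mono_set _ Set.subset_union_right))]

lemma ae_restrict_eq_zero_of_foldFun (s : ℝ)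
    (h : ∀ᵐ x, (Set.Ioc a b).indicator f x = 0 ∧ (Set.Ioc c d).indicator f (x + s) = 0) :
    f =ᵐ[volume.restrict (Set.Ioc a b ∪ Set.Ioc c d)] 0 := by
  have h2 : ∀ᵐ x, (Set.Ioc c d).indicator f x = 0 := by
    have := (measurePreserving_sub_right volume s).quasiMeasurePreserving.ae
      (h.mono fun x hx => hx.2)
    simpa using this
  rw [Filter.EventuallyEq, ae_restrict_iff' (measurableSet_Ioc.union measurableSet_Ioc)]
  filter_upwards [h, h2] with x h1 h2 hx
  rcases hx with hx | hx
  · simpa [hx] using h1.1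
  · simpa [hx] using h2

/-- If the gap between the intervals is a multiple of their total length `l`, then their union is a
fundamental domain of `lℤ`, and `l⁻¹ℤ` is a spectrum. -/
lemma isSpectral_of_gap_eq (hab : a ≤ b) (hbc : b ≤ c) (hcd : c ≤ d)
    (hl : 0 < (b - a) + (d - c)) (k : ℤ) (hk : c - b = k * ((b - a) + (d - c))) :
    IsSpectral (Set.Ioc a b ∪ Set.Ioc c d) := by
  have := isFiniteMeasure_restrict_Ioc_union_Ioc (a := a) (b := b) (c := c) (d := d)
  set l := (b - a) + (d - c) with hl_def
  have hgap : ∀ m : ℤ, (m / l : ℝ) * (c - b) = (m * k : ℤ) := by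
    intro m
    rw [hk]
    push_cast
    field_simp
  refine ⟨Set.range fun m : ℤ => (m / l : ℝ), fun ξ _ => memLp_expFun ξ 2, ?_, fun f hf h => ?_⟩
  · rintro _ ⟨m, rfl⟩ _ ⟨m', rfl⟩ hne
    simp only [expFun_mul_conj] at hne ⊢
    have e : (m / l - m' / l : ℝ) = ((m - m' : ℤ) : ℝ) / l := by
      push_cast
      ring
    refine (indFT_Ioc_union_Ioc_eq_zero_iff hab hbc hcd (sub_ne_zero.2 hne)).2 ?_
    rw [e]
    rw [expFun_eq_expFun_iff.2 ⟨_, hgap (m - m')⟩, add_comm]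
    congr 1
    refine expFun_eq_expFun_iff.2 ⟨(m - m') * (k + 1), ?_⟩
    have : d - a = (k + 1) * l := by linarith
    rw [this]
    push_cast
    field_simp
  · have hsupp : ∀ x, x ∉ Set.Ioc a (a + l) → foldFun a b c d (c - b) 1 f x = 0 := by
      intro x hx
      have h1 : x ∉ Set.Ioc a b := fun h => hx ⟨h.1, by linarith [h.2]⟩
      have h2 : x + (c - b) ∉ Set.Ioc c d := fun h => hx ⟨by linarith [h.1], by linarith [h.2]⟩
      simp [foldFun, h1, h2]
    have hz := ae_eq_zero_of_integral_conj_expFun (a := a) (b := a + l) (by linarith) 0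
      (memLp_foldFun hf _ _) hsupp fun m => by
        rw [add_sub_cancel_left, add_zero, integral_foldFun hbc hf]
        · exact h _ ⟨m, rfl⟩
        · rw [one_mul]
          exact expFun_eq_one_iff.2 ⟨_, hgap m⟩
    refine ae_restrict_eq_zero_of_foldFun (c - b) ?_
    filter_upwards [hz] with x hx
    rw [foldFun, one_mul] at hx
    by_cases hxb : x ≤ b
    · have h2 : x + (c - b) ∉ Set.Ioc c d := fun h => by linarith [h.1]
      simpa [h2] using hx
    · have h1 : x ∉ Set.Ioc a b := fun h => hxb h.2
      simpa [h1] using hx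

/-- If the intervals have the same length `r` and one is the translate of the other by a multiple
`s` of `r`, then `r⁻¹ℤ ∪ (r⁻¹ℤ + (2s)⁻¹)` is a spectrum: the frequencies of the two parts see the
even and the odd parts of a function under the exchange of the intervals. -/
lemma isSpectral_of_equal_length {r s : ℝ} (hr : 0 < r) (hs : r ≤ s) (k : ℤ) (hk : s = k * r) :
    IsSpectral (Set.Ioc a (a + r) ∪ Set.Ioc (a + s) (a + s + r)) := by
  have := isFiniteMeasure_restrict_Ioc_union_Ioc (a := a) (b := a + r) (c := a + s)
    (d := a + s + r)
  have hs0 : s ≠ 0 := by linarith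
  have hbc : a + r ≤ a + s := by linarith
  set Λ : Set ℝ := {ξ | ∃ m : ℤ, ξ = m / r ∨ ξ = m / r + 1 / (2 * s)} with hΛ
  have hzero : ∀ ξ : ℝ, ξ ≠ 0 → ((∃ m : ℤ, ξ * r = m) ∨ ∃ m : ℤ, ξ * s = m + 1 / 2) →
      indFT (Set.Ioc a (a + r) ∪ Set.Ioc (a + s) (a + s + r)) ξ = 0 := by
    intro ξ hξ h
    rw [indFT_Ioc_union_Ioc_eq_zero_iff (by linarith) hbc (by linarith) hξ]
    rcases h with ⟨m, hm⟩ | ⟨m, hm⟩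
    · rw [expFun_eq_expFun_iff (x := a + r) (y := a).2 ⟨m, by simpa using hm⟩,
        expFun_eq_expFun_iff (x := a + s + r) (y := a + s).2 ⟨m, by simpa using hm⟩]
    · rw [expFun_eq_neg_expFun_iff (x := a + s + r) (y := a + r).2
          ⟨m, by rw [← hm]; ring⟩,
        expFun_eq_neg_expFun_iff (x := a + s) (y := a).2 ⟨m, by rw [← hm]; ring⟩]
      ring
  refine ⟨Λ, fun ξ _ => memLp_expFun ξ 2, ?_, fun f hf h => ?_⟩
  · rintro ξ ⟨m, hm⟩ η ⟨m', hm'⟩ hne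
    simp only [expFun_mul_conj]
    refine hzero _ (sub_ne_zero.2 hne) ?_
    rcases hm with rfl | rfl <;> rcases hm' with rfl | rfl
    · refine .inl ⟨m - m', ?_⟩
      push_cast
      field_simp
    · refine .inr ⟨(m - m') * k - 1, ?_⟩
      have e : (m / r - (m' / r + 1 / (2 * s))) * s = (m - m') * (s / r) - 1 / 2 := by
        field_simp
        ring
      rw [e, hk]
      push_cast
      field_simp
      ring
    · refine .inr ⟨(m - m') * k, ?_⟩
      have e : (m / r + 1 / (2 * s) - m' / r) * s = (m - m') * (s / r) + 1 / 2 := by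
        field_simp
        ring
      rw [e, hk]
      push_cast
      field_simp
    · refine .inl ⟨m - m', ?_⟩
      push_cast
      field_simp
      ring
  · have hsupp : ∀ ζ : ℂ, ∀ x, x ∉ Set.Ioc a (a + r) →
        foldFun a (a + r) (a + s) (a + s + r) s ζ f x = 0 := by
      intro ζ x hx
      have h2 : x + s ∉ Set.Ioc (a + s) (a + s + r) := fun h =>
        hx ⟨by linarith [h.1], by linarith [h.2]⟩
      simp [foldFun, hx, h2]
    have h1 := ae_eq_zero_of_integral_conj_expFun (a := a) (b := a + r) (by linarith) 0
      (memLp_foldFun hf s 1) (hsupp 1) fun m => by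
        rw [add_sub_cancel_left, add_zero, integral_foldFun hbc hf]
        · exact h _ ⟨m, .inl rfl⟩
        · rw [one_mul]
          refine expFun_eq_one_iff.2 ⟨m * k, ?_⟩
          rw [hk]
          push_cast
          field_simp
    have h2 := ae_eq_zero_of_integral_conj_expFun (a := a) (b := a + r) (by linarith)
      (1 / (2 * s)) (memLp_foldFun hf s (-1)) (hsupp (-1)) fun m => by
        rw [add_sub_cancel_left, integral_foldFun hbc hf]
        · exact h _ ⟨m, .inr rfl⟩
        · have : expFun (m / r + 1 / (2 * s)) s = -expFun (m / r + 1 / (2 * s)) 0 := by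
            refine expFun_eq_neg_expFun_iff.2 ⟨m * k, ?_⟩
            have e : (m / r + 1 / (2 * s)) * (s - 0) = m * (s / r) + 1 / 2 := by
              field_simp
              ring
            rw [e, hk]
            push_cast
            field_simp
          rw [this, expFun_real]
          simp
    refine ae_restrict_eq_zero_of_foldFun s ?_
    filter_upwards [h1, h2] with x hx1 hx2
    simp only [foldFun, Pi.zero_apply] at hx1 hx2
    constructor
    · linear_combination (hx1 + hx2) / 2
    · linear_combination (hx1 - hx2) / 2

end Spectra

/-! ### Cylinders over two intervals -/

section TwoIntervals

variable {n : ℕ} {a b c d : ℝ} {B : Set (EuclideanSpace ℝ (Fin n))}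

/-- The density bound for a cylinder over two intervals, with real-valued measures. -/
lemma mul_volumeReal_le_one (hab : a ≤ b) (hbc : b ≤ c) (hcd : c ≤ d)
    (hl : 0 < (b - a) + (d - c)) (hBm : MeasurableSet B) (hB : volume B ≠ ∞) (hB0 : volume B ≠ 0)
    (hspec : IsSpectral (cylinderSet (Set.Ioc a b ∪ Set.Ioc c d) B)) {T : Set ℝ}
    (hTm : MeasurableSet T) (hTfin : volume T ≠ ∞) (hT : ∀ s ∈ T, ∀ t ∈ T, s ≠ t →
      indFT (Set.Ioc a b ∪ Set.Ioc c d) (s - t) ≠ 0) :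
    ((b - a) + (d - c)) * volume.real T ≤ 1 ∧
      (1 ≤ ((b - a) + (d - c)) * volume.real T → IsSpectral B) := by
  have hvol := volume_Ioc_union_Ioc hab hbc hcd
  obtain ⟨h1, h2⟩ := volume_mul_le_one_of_isSpectral_cylinderSet
    (measurableSet_Ioc.union measurableSet_Ioc) (by rw [hvol]; simp)
    (by rw [hvol]; simpa using hl) hBm hB hB0 hspec hTm hT
  have e : volume (Set.Ioc a b ∪ Set.Ioc c d) * volume T =
      ENNReal.ofReal (((b - a) + (d - c)) * volume.real T) := by
    rw [hvol, ENNReal.ofReal_mul hl.le, ofReal_measureReal hTfin]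
  rw [e] at h1 h2
  have h3 : ((b - a) + (d - c)) * volume.real T ≤ 1 := by simpa using h1
  exact ⟨h3, fun h => h2 (by rw [le_antisymm h3 h, ENNReal.ofReal_one])⟩

lemma mul_le_one_of_forall_indFT_ne_zero (hab : a ≤ b) (hbc : b ≤ c) (hcd : c ≤ d)
    (hl : 0 < (b - a) + (d - c)) (hBm : MeasurableSet B) (hB : volume B ≠ ∞) (hB0 : volume B ≠ 0)
    (hspec : IsSpectral (cylinderSet (Set.Ioc a b ∪ Set.Ioc c d) B)) {r : ℝ} (hr : 0 ≤ r)
    (h : ∀ ξ, 0 < ξ → ξ < r → indFT (Set.Ioc a b ∪ Set.Ioc c d) ξ ≠ 0) :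
    ((b - a) + (d - c)) * r ≤ 1 ∧ (1 ≤ ((b - a) + (d - c)) * r → IsSpectral B) := by
  have e : volume.real (Set.Ico 0 r) = r := by simp [hr]
  have := mul_volumeReal_le_one hab hbc hcd hl hBm hB hB0 hspec (T := Set.Ico 0 r)
    measurableSet_Ico (by simp) fun s hs t ht hst => by
      rcases lt_or_gt_of_ne hst with hlt | hlt
      · rw [← neg_sub, indFT_neg, ne_eq, map_eq_zero]
        exact h _ (by linarith) (by linarith [hs.1, ht.2])
      · exact h _ (by linarith) (by linarith [ht.1, hs.2])
  rwa [e] at this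

/-- With intervals of different lengths there are no zeros of the transform between `0` and `l⁻¹`,
`l` being the total length, and spectrality of the cylinder forces a zero at `l⁻¹`. -/
lemma isSpectral_of_length_ne (hab : a ≤ b) (hbc : b < c) (hcd : c ≤ d)
    (hne : b - a ≠ d - c) (hBm : MeasurableSet B) (hB : volume B ≠ ∞)
    (hB0 : volume B ≠ 0) (hspec : IsSpectral (cylinderSet (Set.Ioc a b ∪ Set.Ioc c d) B)) :
    IsSpectral (Set.Ioc a b ∪ Set.Ioc c d) ∧ IsSpectral B := by
  have hl : 0 < (b - a) + (d - c) := by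
    rcases lt_or_gt_of_ne hne with h | h <;> linarith
  set l := (b - a) + (d - c) with hl_def
  have hδ : 0 < |(d - c) - (b - a)| := abs_pos.2 (sub_ne_zero.2 hne.symm)
  have hδl : |(d - c) - (b - a)| ≤ l := abs_le.2 ⟨by linarith, by linarith⟩
  have hint : ∀ x : ℝ, 0 < x → x < 1 → ¬ ∃ k : ℤ, x = k := by
    rintro x h0 h1 ⟨k, rfl⟩
    have h0' : 0 < k := by exact_mod_cast h0
    have h1' : k < 1 := by exact_mod_cast h1
    omega
  -- Below `1 / |(d - c) - (b - a)|` only multiples of `1 / l` can be zeros.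
  have hzero : ∀ ξ, 0 < ξ → ξ * |(d - c) - (b - a)| < 1 →
      indFT (Set.Ioc a b ∪ Set.Ioc c d) ξ = 0 →
      (∃ k : ℤ, ξ * l = k) ∧
        ((∃ k : ℤ, ξ * (b - a) = k) ∨ ∃ k : ℤ, ξ * (b - c) = k) := by
    intro ξ hξ hξδ h0
    rcases exists_int_of_indFT_eq_zero hab hbc.le hcd hξ.ne' h0 with
      ⟨⟨j, hj⟩, k, hk⟩ | ⟨⟨j, hj⟩, k, hk⟩ | ⟨⟨j, hj⟩, k, hk⟩
    · exact ⟨⟨j + k, by push_cast; rw [← hj, ← hk]; ring⟩, .inl ⟨j, hj⟩⟩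
    · exact ⟨⟨j + k, by push_cast; rw [← hj, ← hk]; ring⟩, .inr ⟨j, hj⟩⟩
    · exfalso
      refine hint (ξ * |(d - c) - (b - a)|) (by positivity) hξδ ?_
      have e : ξ * ((d - c) - (b - a)) = (j - k : ℤ) := by
        push_cast
        linear_combination hj - hk
      rw [← abs_of_pos hξ, ← abs_mul, e]
      exact ⟨|j - k|, by push_cast; rfl⟩
  refine ⟨?_, (mul_le_one_of_forall_indFT_ne_zero hab hbc.le hcd hl hBm hB hB0 hspec
    (r := 1 / l) (by positivity) fun ξ h0 h1 h => ?_).2 (by rw [← hl_def]; field_simp; rfl)⟩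
  swap
  · rw [lt_div_iff₀ hl] at h1
    refine hint (ξ * l) (by positivity) h1 (hzero ξ h0 ?_ h).1
    exact (mul_le_mul_of_nonneg_left hδl h0.le).trans_lt h1
  -- If one interval is degenerate, it may be taken adjacent to the other.
  rcases hab.eq_or_lt with rfl | hab'
  · have h := isSpectral_of_gap_eq (le_refl c) (le_refl c) hcd (by linarith) 0 (by simp)
    simpa using h
  rcases hcd.eq_or_lt with rfl | hcd'
  · have h := isSpectral_of_gap_eq hab (le_refl b) (le_refl b) (by linarith) 0 (by simp)
    simpa using h
  have hδl' : |(d - c) - (b - a)| < l := abs_lt.2 ⟨by linarith, by linarith⟩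
  -- Otherwise `[0, r)`, with some `r > 1 / l`, violates the density bound.
  have hz : indFT (Set.Ioc a b ∪ Set.Ioc c d) (1 / l) = 0 := by
    by_contra hnz
    set r := min (2 / l) (1 / |(d - c) - (b - a)|) with hr
    have hrl : 1 / l < r := by
      refine lt_min (by gcongr; norm_num) ?_
      exact one_div_lt_one_div_of_lt hδ hδl'
    have h := (mul_le_one_of_forall_indFT_ne_zero hab hbc.le hcd hl hBm hB hB0 hspec
      (r := r) ((by positivity : 0 ≤ 1 / l).trans hrl.le) fun ξ h0 h1 h => ?_).1
    · rw [div_lt_iff₀ hl] at hrl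
      linarith
    · have h2 : ξ * l < 2 := (lt_div_iff₀ hl).1 (h1.trans_le (min_le_left _ _))
      have h3 := (lt_div_iff₀ hδ).1 (h1.trans_le (min_le_right _ _))
      obtain ⟨k, hk⟩ := (hzero ξ h0 h3 h).1
      have hk0 : 0 < k := by
        have : 0 < ξ * l := by positivity
        rw [hk] at this
        exact_mod_cast this
      have hk2 : k < 2 := by
        rw [hk] at h2
        exact_mod_cast h2
      obtain rfl : k = 1 := by omega
      refine hnz ?_
      rw [← h]
      congr 1
      rw [div_eq_iff hl.ne', hk]
      simp
  obtain ⟨-, ⟨k, hk⟩ | ⟨k, hk⟩⟩ := hzero (1 / l) (by positivity)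
    (by rwa [one_div_mul_eq_div, div_lt_one hl]) hz
  · exact absurd ⟨k, hk⟩ (hint _ (mul_pos (by positivity) (by linarith))
      (by rw [one_div_mul_eq_div, div_lt_one hl]; linarith))
  · refine isSpectral_of_gap_eq hab hbc.le hcd hl (-k) ?_
    rw [one_div_mul_eq_div, div_eq_iff hl.ne'] at hk
    push_cast
    linarith

/-- For two intervals of length `r`, one the translate of the other by `s`, the set of all
`t ∈ [0, r⁻¹)` for which `⌊2st⌋` is even meets the density bound only if `s` is a multiple
of `r`. -/
lemma isSpectral_of_length_eq {r s : ℝ} (hr : 0 < r) (hs : r < s) (hBm : MeasurableSet B)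
    (hB : volume B ≠ ∞) (hB0 : volume B ≠ 0)
    (hspec : IsSpectral (cylinderSet (Set.Ioc a (a + r) ∪ Set.Ioc (a + s) (a + s + r)) B)) :
    IsSpectral (Set.Ioc a (a + r) ∪ Set.Ioc (a + s) (a + s + r)) ∧ IsSpectral B := by
  have hs0 : 0 < s := hr.trans hs
  set δ := 1 / (2 * s) with hδ
  have hδ0 : 0 < δ := by positivity
  have hδs : 2 * s * δ = 1 := by rw [hδ]; field_simp
  set T : Set ℝ := Set.Ico 0 (1 / r) ∩ {t | Even ⌊2 * s * t⌋} with hT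
  set T' : Set ℝ := Set.Ico 0 (1 / r) ∩ {t | Even ⌊2 * s * t⌋}ᶜ with hT'
  have hEm : MeasurableSet {t : ℝ | Even ⌊2 * s * t⌋} :=
    (Int.measurable_floor.comp (measurable_const_mul (2 * s)))
      (MeasurableSet.of_discrete (s := {k : ℤ | Even k}))
  have hTm : MeasurableSet T := measurableSet_Ico.inter hEm
  have hTm' : MeasurableSet T' := measurableSet_Ico.inter hEm.compl
  have hTfin : volume T ≠ ∞ := measure_ne_top_of_subset Set.inter_subset_left (by simp)
  have hTfin' : volume T' ≠ ∞ := measure_ne_top_of_subset Set.inter_subset_left (by simp)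
  have hTT' : volume.real T + volume.real T' = 1 / r := by
    have h := measureReal_inter_add_sdiff (μ := volume) (s := Set.Ico 0 (1 / r)) hEm (by simp)
    rw [Set.sdiff_eq] at h
    rw [h]
    simp [hr.le]
  -- A zero of the transform in `(-r⁻¹, r⁻¹)` is an odd multiple of `δ`.
  have hTz : ∀ u ∈ T, ∀ v ∈ T, u ≠ v →
      indFT (Set.Ioc a (a + r) ∪ Set.Ioc (a + s) (a + s + r)) (u - v) ≠ 0 := by
    intro u hu v hv huv h
    have hmul : ∀ k : ℤ, (u - v) * r ≠ k := by
      intro k hk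
      have h1 : |(u - v) * r| < 1 := by
        rw [abs_mul, abs_of_pos hr, ← lt_div_iff₀ hr, abs_lt]
        exact ⟨by linarith [hu.1.1, hv.1.2], by linarith [hv.1.1, hu.1.2]⟩
      rw [hk] at h1
      have h2 : |k| < 1 := by exact_mod_cast h1
      rw [Int.abs_lt_one_iff] at h2
      rw [h2, Int.cast_zero] at hk
      exact (mul_ne_zero (sub_ne_zero.2 huv) hr.ne') hk
    have hodd : ∃ k : ℤ, (u - v) * s = k + 1 / 2 := by
      rcases exists_int_of_indFT_eq_zero (by linarith) (by linarith) (by linarith)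
        (sub_ne_zero.2 huv) h with ⟨⟨j, hj⟩, -⟩ | ⟨⟨j, hj⟩, k, hk⟩ | ⟨-, k, hk⟩
      · exact absurd (by linear_combination hj) (hmul j)
      · have e : 2 * ((u - v) * s) = (k - j : ℤ) := by
          push_cast
          linear_combination hk - hj
        rcases Int.even_or_odd' (k - j) with ⟨i, hi | hi⟩
        · refine absurd ?_ (hmul (j + i))
          rw [hi] at e
          push_cast at e ⊢
          linear_combination hj + e / 2
        · refine ⟨i, ?_⟩
          rw [hi] at e
          push_cast at e
          linear_combination e / 2
      · exact ⟨k, by linear_combination hk⟩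
    obtain ⟨k, hk⟩ := hodd
    have e : 2 * s * u = 2 * s * v + (2 * k + 1 : ℤ) := by
      push_cast
      linear_combination 2 * hk
    have h1 : Even ⌊2 * s * u⌋ := hu.2
    have h2 : Even ⌊2 * s * v⌋ := hv.2
    rw [e, Int.floor_add_intCast] at h1
    exact (Int.not_even_iff_odd.2 (h2.add_odd ⟨k, rfl⟩)) h1
  obtain ⟨hle, hBspec⟩ := mul_volumeReal_le_one (by linarith) (by linarith) (by linarith)
    (by linarith) hBm hB hB0 hspec hTm hTfin hTz
  have e2 : a + r - a + (a + s + r - (a + s)) = 2 * r := by ring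
  rw [e2] at hle hBspec
  -- Translation by `-δ` maps the complement `T'` of `T` into `T`, and misses the interval `I`.
  set m := ⌊s / r⌋ with hm
  set I : Set ℝ := Set.Ico (max (2 * m * δ) (1 / r - δ)) (min (1 / r) ((2 * m + 1) * δ)) with hI
  have hm0 : (0 : ℝ) ≤ m := by exact_mod_cast Int.floor_nonneg.2 (by positivity : 0 ≤ s / r)
  have hIT : I ⊆ T := by
    rintro t ⟨h1, h2⟩
    rw [max_le_iff] at h1
    rw [lt_min_iff] at h2
    have ht0 : 0 ≤ t := le_trans (by positivity) h1.1
    refine ⟨⟨ht0, h2.1⟩, ?_⟩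
    have : ⌊2 * s * t⌋ = 2 * m := by
      rw [Int.floor_eq_iff]
      push_cast
      have h3 := mul_le_mul_of_nonneg_left h1.1 (by positivity : 0 ≤ 2 * s)
      have h4 := mul_lt_mul_of_pos_left h2.2 (by positivity : 0 < 2 * s)
      constructor
      · linear_combination h3 - 2 * m * hδs
      · linear_combination h4 + (2 * m + 1) * hδs
    change Even ⌊2 * s * t⌋
    rw [this]
    exact even_two_mul m
  have hsub : (fun t => t + δ) ⁻¹' T' ⊆ T := by
    intro t ht
    obtain ⟨⟨h1, h2⟩, h3⟩ := ht
    change 0 ≤ t + δ at h1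
    change t + δ < 1 / r at h2
    change ¬ Even ⌊2 * s * (t + δ)⌋ at h3
    have e : 2 * s * (t + δ) = 2 * s * t + 1 := by linear_combination hδs
    rw [e, Int.floor_add_one, Int.even_add_one, not_not] at h3
    refine ⟨⟨?_, by linarith⟩, h3⟩
    by_contra! hneg
    -- Were `t` negative, `⌊2st⌋` would be `-1`, which is odd.
    have : ⌊2 * s * t⌋ = -1 := by
      rw [Int.floor_eq_iff]
      push_cast
      have h4 := mul_nonneg (by positivity : 0 ≤ 2 * s) h1
      have h5 := mul_neg_of_pos_of_neg (by positivity : 0 < 2 * s) hneg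
      constructor
      · linear_combination h4 + e
      · linarith
    rw [this] at h3
    exact absurd h3 (by decide)
  have hdisj : Disjoint I ((fun t => t + δ) ⁻¹' T') := by
    rw [Set.disjoint_left]
    rintro t ⟨h1, -⟩ ht
    have h2 := (le_max_right _ _).trans h1
    have h3 : t + δ < 1 / r := ht.1.2
    linarith
  have hpre : volume.real ((fun t => t + δ) ⁻¹' T') = volume.real T' := by
    rw [Measure.real, measure_preimage_add_right, Measure.real]
  have hsum : volume.real I + volume.real T' ≤ volume.real T := by
    rw [← hpre, ← measureReal_union hdisj (measurable_add_const δ hTm')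
      (measure_ne_top_of_subset hIT hTfin) (measure_ne_top_of_subset hsub hTfin)]
    exact measureReal_mono (Set.union_subset hIT hsub) hTfin
  have hr1 : r * (1 / r) = 1 := by field_simp
  have hI0 : volume.real I ≤ 0 := by
    have h1 : r * (volume.real I + 1 / r) ≤ r * (2 * volume.real T) :=
      mul_le_mul_of_nonneg_left (by linarith) hr.le
    have h2 : r * volume.real I ≤ 0 := by linarith
    exact nonpos_of_mul_nonpos_right h2 hr
  refine ⟨?_, hBspec ?_⟩
  swap
  · have h0 : 0 ≤ volume.real I := measureReal_nonneg
    have h1 : r * (1 / r) ≤ r * (2 * volume.real T) :=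
      mul_le_mul_of_nonneg_left (by linarith) hr.le
    linarith
  refine isSpectral_of_equal_length hr hs.le m ?_
  have hmr : m * r ≤ s := (le_div_iff₀ hr).1 (Int.floor_le _)
  have hmr' : s < (m + 1) * r := (div_lt_iff₀ hr).1 (Int.lt_floor_add_one _)
  have hIle : min (1 / r) ((2 * m + 1) * δ) ≤ max (2 * m * δ) (1 / r - δ) := by
    rw [hI, Real.volume_real_Ico] at hI0
    linarith [le_max_left (min (1 / r) ((2 * m + 1) * δ) - max (2 * m * δ) (1 / r - δ)) 0]
  have hrδ : ∀ x : ℝ, 1 / r ≤ 2 * x * δ ↔ s ≤ x * r := by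
    intro x
    rw [hδ, div_le_iff₀ hr]
    field_simp
  rcases min_le_iff.1 hIle with h | h <;> rcases le_max_iff.1 h with h | h
  · exact le_antisymm ((hrδ m).1 h) hmr
  · linarith
  · linarith
  · have : 2 * (m + 1) * δ ≤ 1 / r := by linarith
    have h3 : ¬ 1 / r < 2 * (m + 1) * δ := not_lt.2 this
    refine absurd ?_ h3
    rw [hδ, div_lt_iff₀ hr]
    field_simp
    linarith

lemma isSpectral_Ioc_union_Ioc_and (hab : a ≤ b) (hbc : b < c) (hcd : c ≤ d)
    (hpos : a < b ∨ c < d) (hBm : MeasurableSet B) (hB : volume B ≠ ∞) (hB0 : volume B ≠ 0)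
    (hspec : IsSpectral (cylinderSet (Set.Ioc a b ∪ Set.Ioc c d) B)) :
    IsSpectral (Set.Ioc a b ∪ Set.Ioc c d) ∧ IsSpectral B := by
  by_cases h : b - a = d - c
  · have hb : b = a + (b - a) := by ring
    have hc : c = a + (c - a) := by ring
    have hd : d = a + (c - a) + (b - a) := by linarith
    rw [hb, hc, hd] at hspec ⊢
    refine isSpectral_of_length_eq ?_ (by linarith) hBm hB hB0 hspec
    rcases hpos with h' | h' <;> linarith
  · exact isSpectral_of_length_ne hab hbc hcd h hBm hB hB0 hspec

lemma cylinderSet_congr_ae {A A' : Set ℝ} {B' : Set (EuclideanSpace ℝ (Fin n))}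
    (hA : A =ᵐ[volume] A') (hB : B =ᵐ[volume] B') :
    cylinderSet A B =ᵐ[volume] cylinderSet A' B' := by
  have h1 := (Measure.quasiMeasurePreserving_fst (μ := (volume : Measure ℝ))
    (ν := (volume : Measure (EuclideanSpace ℝ (Fin n))))).comp
    measurePreserving_headTail.quasiMeasurePreserving
  have h2 := (Measure.quasiMeasurePreserving_snd (μ := (volume : Measure ℝ))
    (ν := (volume : Measure (EuclideanSpace ℝ (Fin n))))).comp
    measurePreserving_headTail.quasiMeasurePreserving
  exact (h1.preimage_ae_eq hA).inter (h2.preimage_ae_eq hB)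

lemma isSpectral_Icc_union_Icc_and (hab : a ≤ b) (hbc : b < c) (hcd : c ≤ d)
    (hpos : a < b ∨ c < d) (hBb : Bornology.IsBounded B) (hBm : NullMeasurableSet B volume)
    (hB0 : volume B ≠ 0) (hspec : IsSpectral (cylinderSet (Set.Icc a b ∪ Set.Icc c d) B)) :
    IsSpectral (Set.Icc a b ∪ Set.Icc c d) ∧ IsSpectral B := by
  have hA : (Set.Icc a b ∪ Set.Icc c d : Set ℝ) =ᵐ[volume] (Set.Ioc a b ∪ Set.Ioc c d : Set ℝ) :=
    Ioc_ae_eq_Icc.symm.union Ioc_ae_eq_Icc.symm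
  have hB' := hBm.toMeasurable_ae_eq
  obtain ⟨h1, h2⟩ := isSpectral_Ioc_union_Ioc_and hab hbc hcd hpos
    (measurableSet_toMeasurable volume B)
    (by rw [measure_toMeasurable]; exact hBb.measure_lt_top.ne)
    (by rwa [measure_toMeasurable]) (hspec.congr (cylinderSet_congr_ae hA hB'.symm))
  exact ⟨h1.congr hA.symm, h2.congr hB'⟩

end TwoIntervals

end

theorem corollary3 (n : ℕ) (a b c d : ℝ) (hab : a ≤ b) (hcd : c ≤ d) (hpos : a < b ∨ c < d)
    (hdisj : Disjoint (Set.Icc a b) (Set.Icc c d))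
    (B : Set (EuclideanSpace ℝ (Fin n)))
    (hBb : Bornology.IsBounded B) (hBm : NullMeasurableSet B volume) (hB0 : volume B ≠ 0)
    (hspec : IsSpectral (cylinderSet (Set.Icc a b ∪ Set.Icc c d) B)) :
    IsSpectral (Set.Icc a b ∪ Set.Icc c d) ∧ IsSpectral B := by
  rcases lt_or_ge b c with hbc | hcb
  · exact isSpectral_Icc_union_Icc_and hab hbc hcd hpos hBb hBm hB0 hspec
  rcases lt_or_ge d a with hda | had
  · rw [Set.union_comm] at hspec ⊢
    exact isSpectral_Icc_union_Icc_and hcd hda hab hpos.symm hBb hBm hB0 hspec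
  · exact (Set.disjoint_left.1 hdisj
      (⟨le_max_left _ _, max_le hab hcb⟩ : max a c ∈ Set.Icc a b)
      ⟨le_max_right _ _, max_le had hcd⟩).elim
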